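/- Let $F$ be an arbitrary field and $h\in F[x]$ with $\deg h\ge 1$. Let $A_h$ be the unital associative $F$-algebra with generators $x,y$ and the single defining relation $yx=xy+h(x)$, and let $\mathrm{Aut}(A_h)$ be its group of $F$-algebra automorphisms. For $f\in F[x]$ let $\phi_f\in\mathrm{Aut}(A_h)$ be given by $\phi_f(x)=x$, $\phi_f(y)=y+f(x)$. Let $\mathbb P=\{(\alpha,\beta)\in F^*\times F \mid h(\alpha x+\beta)=\alpha^{\deg h}h(x)\}$ and for $(\alpha,\beta)\in\mathbb P$ let $\tau_{\alpha,\beta}\in\mathrm{Aut}(A_h)$ be given by $\tau_{\alpha,\beta}(x)=\alpha x+\beta$, $\tau_{\alpha,\beta}(y)=\alpha^{\deg h-1}y$. Consider the subgroups $\tau_{\mathbb P}=\{\tau_{\alpha,\beta}\mid(\alpha,\beta)\in\mathbb P\}$ and $\tau_{1,\mathbb G}=\{\tau_{1,\nu}\mid (1,\nu)\in\mathbb P\}$ of $\mathrm{Aut}(A_h)$. Then: (a) The homomorphism $(F[x],+)\to\mathrm{Aut}(A_h)$, $f\mapsto\phi_f$, is injective; its image, identified with $F[x]$, is a normal subgroup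 of $\mathrm{Aut}(A_h)$, and $\mathrm{Aut}(A_h)=F[x]\rtimes\tau_{\mathbb P}$ (internal semidirect product). (b) $\tau_{1,\mathbb G}$ is isomorphic to a finite subgroup of $(F,+)$, which is trivial when $\mathrm{char}(F)=0$. (c) The subgroups $F[x]$ and $\tau_{1,\mathbb G}$ generate their internal semidirect product $F[x]\rtimes\tau_{1,\mathbb G}$, and this is a normal subgroup of $\mathrm{Aut}(A_h)$. -/

import Mathlib

open Polynomial

universe u

/-- The two generators of the free algebra. -/
inductive AhGen : Type
  | x
  | y

/-- The defining relation `y x = x y + h(x)` on the free algebra on `x`, `y`. -/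
inductive AhRel {F : Type u} [Field F] (h : F[X]) :
    FreeAlgebra F AhGen → FreeAlgebra F AhGen → Prop
  | rel : AhRel h
      (FreeAlgebra.ι F AhGen.y * FreeAlgebra.ι F AhGen.x)
      (FreeAlgebra.ι F AhGen.x * FreeAlgebra.ι F AhGen.y
        + aeval (FreeAlgebra.ι F AhGen.x) h)

/-- The algebra `A_h`: the unital associative `F`-algebra with generators `x`, `y` and the
single defining relation `y x = x y + h(x)`. -/
def Ah {F : Type u} [Field F] (h : F[X]) : Type u := RingQuot (AhRel h)

namespace Ah

variable {F : Type u} [Field F] (h : F[X])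

instance : Ring (Ah h) := inferInstanceAs (Ring (RingQuot (AhRel h)))

instance : Algebra F (Ah h) := inferInstanceAs (Algebra F (RingQuot (AhRel h)))

/-- The quotient map from the free algebra. -/
def mk : FreeAlgebra F AhGen →ₐ[F] Ah h := RingQuot.mkAlgHom F (AhRel h)

/-- The generator `x`. -/
def x : Ah h := mk h (FreeAlgebra.ι F AhGen.x)

/-- The generator `y`. -/
def y : Ah h := mk h (FreeAlgebra.ι F AhGen.y)

/-- The canonical map `F[x] → A_h`, `f ↦ f(x)`. -/
noncomputable def ofPoly : F[X] →ₐ[F] Ah h := aeval (x h)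

theorem y_mul_x : y h * x h = x h * y h + ofPoly h h := by
  have H : mk h _ = mk h _ := RingQuot.mkAlgHom_rel F (AhRel.rel (h := h))
  rw [map_mul, map_add, map_mul, ← aeval_algHom_apply] at H
  exact H

/-- The universal property of `A_h`. -/
def lift {B : Type*} [Ring B] [Algebra F B] (a b : B) (hab : b * a = a * b + aeval a h) :
    Ah h →ₐ[F] B :=
  RingQuot.liftAlgHom F
    ⟨FreeAlgebra.lift F (fun g => match g with | .x => a | .y => b), by
      rintro _ _ ⟨⟩
      rw [map_mul, map_add, map_mul, ← aeval_algHom_apply]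
      simpa using hab⟩

@[simp] theorem lift_x {B : Type*} [Ring B] [Algebra F B] (a b : B)
    (hab : b * a = a * b + aeval a h) : lift h a b hab (x h) = a := by
  refine (RingQuot.liftAlgHom_mkAlgHom_apply F _ _ _).trans ?_
  simp

@[simp] theorem lift_y {B : Type*} [Ring B] [Algebra F B] (a b : B)
    (hab : b * a = a * b + aeval a h) : lift h a b hab (y h) = b := by
  refine (RingQuot.liftAlgHom_mkAlgHom_apply F _ _ _).trans ?_
  simp

variable {h} in
theorem hom_ext {B : Type*} [Ring B] [Algebra F B] {f g : Ah h →ₐ[F] B}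
    (hx : f (x h) = g (x h)) (hy : f (y h) = g (y h)) : f = g := by
  refine RingQuot.ringQuot_ext' F f g ?_
  ext z
  cases z
  · exact hx
  · exact hy

variable {h} in
theorem equiv_ext {f g : Ah h ≃ₐ[F] Ah h}
    (hx : f (x h) = g (x h)) (hy : f (y h) = g (y h)) : f = g := by
  have : (f : Ah h →ₐ[F] Ah h) = (g : Ah h →ₐ[F] Ah h) := hom_ext hx hy
  exact AlgEquiv.ext fun a => DFunLike.congr_fun this a

theorem commute_ofPoly (f : F[X]) : ofPoly h f * x h = x h * ofPoly h f := by
  have : ofPoly h (X * f) = ofPoly h (f * X) := by rw [mul_comm]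
  simpa [ofPoly] using this.symm

/-- The endomorphism `x ↦ x`, `y ↦ y + f(x)`. -/
noncomputable def phiHom (f : F[X]) : Ah h →ₐ[F] Ah h :=
  lift h (x h) (y h + ofPoly h f) (by
    rw [add_mul, mul_add, y_mul_x, commute_ofPoly]
    simp only [ofPoly]
    abel)

@[simp] theorem phiHom_x (f : F[X]) : phiHom h f (x h) = x h := lift_x h _ _ _

@[simp] theorem phiHom_y (f : F[X]) : phiHom h f (y h) = y h + ofPoly h f := lift_y h _ _ _

@[simp] theorem phiHom_ofPoly (f g : F[X]) : phiHom h f (ofPoly h g) = ofPoly h g := by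
  simp only [ofPoly]
  rw [← aeval_algHom_apply, phiHom_x]

/-- The automorphism `φ_f` of `A_h`: `φ_f(x) = x`, `φ_f(y) = y + f(x)`. -/
noncomputable def phi (f : F[X]) : Ah h ≃ₐ[F] Ah h :=
  AlgEquiv.ofAlgHom (phiHom h f) (phiHom h (-f))
    (hom_ext (by simp) (by simp)) (hom_ext (by simp) (by simp))

@[simp] theorem phi_x (f : F[X]) : phi h f (x h) = x h := phiHom_x h f

@[simp] theorem phi_y (f : F[X]) : phi h f (y h) = y h + ofPoly h f := phiHom_y h f

@[simp] theorem phi_ofPoly (f g : F[X]) : phi h f (ofPoly h g) = ofPoly h g :=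
  phiHom_ofPoly h f g

/-- The group homomorphism `(F[x], +) → Aut(A_h)`, `f ↦ φ_f`. -/
noncomputable def phiMonoidHom : Multiplicative F[X] →* (Ah h ≃ₐ[F] Ah h) where
  toFun f := phi h f.toAdd
  map_one' := equiv_ext (by simp) (by simp)
  map_mul' f g := equiv_ext (by simp) (by simp; abel)

/-- The copy `{φ_f | f ∈ F[x]}` of `F[x]` in `Aut(A_h)`. -/
noncomputable def phiSubgroup : Subgroup (Ah h ≃ₐ[F] Ah h) := (phiMonoidHom h).range

/-- The set `ℙ` of pairs `(α, β) ∈ F* × F` with `h(α x + β) = α ^ (deg h) h(x)`. -/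
def affinePairs : Set (Fˣ × F) :=
  {p | h.comp (C (p.1 : F) * X + C p.2) = C ((p.1 : F) ^ h.natDegree) * h}

theorem affinePairs_inv {p : Fˣ × F} (hp : p ∈ affinePairs h) :
    ((p.1⁻¹, -((p.1⁻¹ : Fˣ) : F) * p.2) : Fˣ × F) ∈ affinePairs h := by
  obtain ⟨α, β⟩ := p
  simp only [affinePairs, Set.mem_ofPred_eq] at hp ⊢
  have h0 : (C (α : F) * X + C β).comp (C ((α⁻¹ : Fˣ) : F) * X + C (-((α⁻¹ : Fˣ) : F) * β))
      = (X : F[X]) := by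
    simp only [add_comp, mul_comp, C_comp, X_comp, mul_add, ← mul_assoc, ← C_mul, neg_mul,
      mul_neg, Units.mul_inv]
    simp
  have h1 := congrArg
    (fun q : F[X] => q.comp (C ((α⁻¹ : Fˣ) : F) * X + C (-((α⁻¹ : Fˣ) : F) * β))) hp
  simp only [comp_assoc, h0, comp_X, mul_comp, C_comp] at h1
  have h2 := congrArg (fun q : F[X] => C (((α⁻¹ : Fˣ) : F) ^ h.natDegree) * q) h1
  simp only [← mul_assoc, ← C_mul, ← mul_pow, Units.inv_mul, one_pow, C_1, one_mul] at h2
  exact h2.symm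

theorem affinePairs_one : ((1, 0) : Fˣ × F) ∈ affinePairs h := by
  simp [affinePairs]

theorem affinePairs_mul {p q : Fˣ × F} (hp : p ∈ affinePairs h) (hq : q ∈ affinePairs h) :
    ((p.1 * q.1, q.1 * p.2 + q.2) : Fˣ × F) ∈ affinePairs h := by
  obtain ⟨α, β⟩ := p
  obtain ⟨γ, δ⟩ := q
  simp only [affinePairs, Set.mem_ofPred_eq] at hp hq ⊢
  have h1 := congrArg (fun r : F[X] => r.comp (C (α : F) * X + C β)) hq
  simp only [comp_assoc, mul_comp, C_comp, hp, add_comp, X_comp] at h1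
  rw [← mul_assoc, ← C_mul, ← mul_pow] at h1
  rw [Units.val_mul, mul_comm (α : F), ← h1]
  congr 1
  simp only [C_add, C_mul]
  ring

/-- The endomorphism `x ↦ α x + β`, `y ↦ α ^ (deg h - 1) y` for `(α, β) ∈ ℙ`. The exponent is
an integer, so there is no truncated subtraction. -/
noncomputable def tauHom (p : Fˣ × F) (hp : p ∈ affinePairs h) : Ah h →ₐ[F] Ah h :=
  lift h ((p.1 : F) • x h + algebraMap F (Ah h) p.2)
    (((p.1 ^ ((h.natDegree : ℤ) - 1) : Fˣ) : F) • y h) (by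
    obtain ⟨α, β⟩ := p
    have e : (α : F) • x h + algebraMap F (Ah h) β = ofPoly h (C (α : F) * X + C β) := by
      simp [ofPoly, Algebra.smul_def]
    have e2 : aeval ((α : F) • x h + algebraMap F (Ah h) β) h
        = ((α : F) ^ h.natDegree) • ofPoly h h := by
      simp only [affinePairs, Set.mem_ofPred_eq] at hp
      rw [e, ofPoly, ← aeval_comp, hp, map_mul, aeval_C, Algebra.smul_def]
    have e3 : ((α ^ ((h.natDegree : ℤ) - 1) : Fˣ) : F) * (α : F) = (α : F) ^ h.natDegree := by
      rw [← Units.val_mul, ← zpow_add_one, sub_add_cancel, zpow_natCast, Units.val_pow_eq_pow_val]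
    rw [e2, ← e3]
    simp only [mul_add, add_mul, smul_mul_smul_comm, y_mul_x, smul_add, Algebra.commutes]
    rw [mul_comm (α : F)]
    abel)

@[simp] theorem tauHom_x (p : Fˣ × F) (hp : p ∈ affinePairs h) :
    tauHom h p hp (x h) = (p.1 : F) • x h + algebraMap F (Ah h) p.2 := lift_x h _ _ _

@[simp] theorem tauHom_y (p : Fˣ × F) (hp : p ∈ affinePairs h) :
    tauHom h p hp (y h) = ((p.1 ^ ((h.natDegree : ℤ) - 1) : Fˣ) : F) • y h := lift_y h _ _ _

/-- The automorphism `τ_{α,β}` of `A_h`: `τ_{α,β}(x) = α x + β`,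
`τ_{α,β}(y) = α ^ (deg h - 1) y`, for `(α, β) ∈ ℙ`. -/
noncomputable def tau (p : Fˣ × F) (hp : p ∈ affinePairs h) : Ah h ≃ₐ[F] Ah h :=
  AlgEquiv.ofAlgHom (tauHom h p hp) (tauHom h _ (affinePairs_inv h hp))
    (hom_ext
      (by
        simp only [AlgHom.comp_apply, tauHom_x, map_add, map_smul, AlgHom.commutes, smul_add,
          smul_smul, Units.inv_mul, one_smul, AlgHom.id_apply, add_assoc]
        simp [Algebra.smul_def])
      (by
        simp only [AlgHom.comp_apply, tauHom_y, map_smul, smul_smul, AlgHom.id_apply]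
        rw [← Units.val_mul, ← mul_zpow]
        simp))
    (hom_ext
      (by
        simp only [AlgHom.comp_apply, tauHom_x, map_add, map_smul, AlgHom.commutes, smul_add,
          smul_smul, Units.mul_inv, one_smul, AlgHom.id_apply, add_assoc]
        rw [Algebra.smul_def, ← map_mul, ← map_add]
        simp)
      (by
        simp only [AlgHom.comp_apply, tauHom_y, map_smul, smul_smul, AlgHom.id_apply]
        rw [← Units.val_mul, ← mul_zpow]
        simp))

@[simp] theorem tau_x (p : Fˣ × F) (hp : p ∈ affinePairs h) :
    tau h p hp (x h) = (p.1 : F) • x h + algebraMap F (Ah h) p.2 := tauHom_x h p hp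

@[simp] theorem tau_y (p : Fˣ × F) (hp : p ∈ affinePairs h) :
    tau h p hp (y h) = ((p.1 ^ ((h.natDegree : ℤ) - 1) : Fˣ) : F) • y h := tauHom_y h p hp

variable {h} in
theorem tau_congr {p q : Fˣ × F} (hp : p ∈ affinePairs h) (e : p = q) :
    tau h p hp = tau h q (e ▸ hp) := by
  subst e
  rfl

theorem tau_one : tau h (1, 0) (affinePairs_one h) = 1 :=
  equiv_ext (by simp) (by simp)

theorem tau_mul {p q : Fˣ × F} (hp : p ∈ affinePairs h) (hq : q ∈ affinePairs h) :
    tau h p hp * tau h q hq = tau h _ (affinePairs_mul h hp hq) :=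
  equiv_ext
    (by
      simp only [AlgEquiv.mul_apply, tau_x, map_add, map_smul, AlgEquiv.commutes, smul_add,
        smul_smul, Units.val_mul, map_mul, add_assoc]
      rw [mul_comm, Algebra.smul_def (q.1 : F) (algebraMap F (Ah h) p.2)])
    (by
      simp only [AlgEquiv.mul_apply, tau_y, map_smul, smul_smul, mul_zpow, Units.val_mul]
      rw [mul_comm])

theorem tau_inv {p : Fˣ × F} (hp : p ∈ affinePairs h) :
    (tau h p hp)⁻¹ = tau h _ (affinePairs_inv h hp) := by
  refine inv_eq_of_mul_eq_one_right ?_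
  rw [tau_mul, ← tau_one]
  exact tau_congr _ (by simp)

/-- The subgroup `τ_ℙ = {τ_{α,β} | (α, β) ∈ ℙ}` of `Aut(A_h)`. -/
noncomputable def tauP : Subgroup (Ah h ≃ₐ[F] Ah h) where
  carrier := {g | ∃ (p : Fˣ × F) (hp : p ∈ affinePairs h), tau h p hp = g}
  one_mem' := ⟨_, affinePairs_one h, tau_one h⟩
  mul_mem' := by
    rintro _ _ ⟨p, hp, rfl⟩ ⟨q, hq, rfl⟩
    exact ⟨_, affinePairs_mul h hp hq, (tau_mul h hp hq).symm⟩
  inv_mem' := by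
    rintro _ ⟨p, hp, rfl⟩
    exact ⟨_, affinePairs_inv h hp, (tau_inv h hp).symm⟩

/-- The subgroup `τ_{1,𝔾} = {τ_{1,ν} | (1, ν) ∈ ℙ}` of `Aut(A_h)`. -/
noncomputable def tauOneG : Subgroup (Ah h ≃ₐ[F] Ah h) where
  carrier := {g | ∃ (ν : F) (hν : ((1, ν) : Fˣ × F) ∈ affinePairs h), tau h (1, ν) hν = g}
  one_mem' := ⟨0, affinePairs_one h, tau_one h⟩
  mul_mem' := by
    rintro _ _ ⟨ν, hν, rfl⟩ ⟨μ, hμ, rfl⟩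
    have key : ((1 * 1, ((1 : Fˣ) : F) * ν + μ) : Fˣ × F) = (1, ν + μ) := by simp
    have hm := affinePairs_mul h hν hμ
    exact ⟨ν + μ, key ▸ hm, ((tau_mul h hν hμ).trans (tau_congr hm key)).symm⟩
  inv_mem' := by
    rintro _ ⟨ν, hν, rfl⟩
    have key : ((1⁻¹, -(((1 : Fˣ)⁻¹ : Fˣ) : F) * ν) : Fˣ × F) = (1, -ν) := by simp
    have hm := affinePairs_inv h hν
    exact ⟨-ν, key ▸ hm, ((tau_inv h hν).trans (tau_congr hm key)).symm⟩

end Ah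

/-- The subgroup `S` is the internal semidirect product `N ⋊ T` of its subgroups `N` and `T`. -/
structure IsInternalSemidirect {G : Type u} [Group G] (N T S : Subgroup G) : Prop where
  left_le : N ≤ S
  right_le : T ≤ S
  normal : (N.subgroupOf S).Normal
  inf_eq_bot : N ⊓ T = ⊥
  sup_eq : N ⊔ T = S

/-! Every element of `A_h` is uniquely `∑ pᵢ(x) yⁱ`. Existence and uniqueness come from letting
`A_h` act on `F[X][Y]`, with `x` acting as `X` and `y` as `Y + h d/dX`. Since `h d/dX` does not
raise the `Y`-degree, the degree in `y` is additive on products of nonzero elements, and `A_h` is a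
domain.

Let `σ` be an automorphism. As `h = yx - xy` and `A_h / h A_h` is commutative, `h` divides `σ(h)`
and also `σ⁻¹(h)`. Applying `σ` to the latter divisibility, `σ(h)` divides `h`, so `σ(h) = h(σ(x))`
has `y`-degree `0`; because `deg h ≥ 1`, so does `σ(x)` (`ydeg_map_x`). The same holds for `σ⁻¹`, so
`σ(x) = αx + β`, and comparing `h(αx + β)` with its divisor `h` puts `(α, β)` in `ℙ`
(`exists_affine`). Next, `σ(y)` has `y`-degree `1` (`ydeg_map_y`), and the defining relation forces
its leading coefficient to be `α ^ (deg h - 1)`. Hence `σ = φ_f τ_{α,β}` (`exists_phi_mul_tau`).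

The group statements follow from the commutation rule `tau_mul_phi` and from the value at `x`, which
`φ_f` fixes and which determines `τ_{α,β}`. A translation `ν` preserving `h` satisfies `h(ν) =
h(0)`, which has finitely many solutions. -/

namespace Ah

/-! ### Normal forms: `A_h` as a free left `F[x]`-module on the powers of `y`. -/

section NormalForm

variable {F : Type u} [Field F] (h : F[X])

/-- The coefficientwise derivation `h d/dX` on `F[X][Y]`. -/
noncomputable def coeffDeriv : F[X][X] →ₗ[F] F[X][X] :=
  lsum fun i => (monomial i).restrictScalars F ∘ₗ LinearMap.mulLeft F h ∘ₗ derivative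

theorem coeffDeriv_monomial (n : ℕ) (f : F[X]) :
    coeffDeriv h (monomial n f) = monomial n (h * derivative f) := by
  simp [coeffDeriv]

theorem coeff_coeffDeriv (p : F[X][X]) (i : ℕ) :
    (coeffDeriv h p).coeff i = h * derivative (p.coeff i) := by
  induction p using Polynomial.induction_on' with
  | add p q hp hq => simp [hp, hq, mul_add]
  | monomial n f =>
    rw [coeffDeriv_monomial, coeff_monomial, coeff_monomial]
    split_ifs <;> simp

/-- Left multiplication by `y` in terms of normal forms. -/
noncomputable def yOp : Module.End F F[X][X] := LinearMap.mulLeft F X + coeffDeriv h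

theorem yOp_apply (p : F[X][X]) : yOp h p = X * p + coeffDeriv h p := rfl

theorem aeval_lmul_C_X (f : F[X]) :
    aeval (Algebra.lmul F F[X][X] (C X)) f = Algebra.lmul F F[X][X] (C f) := by
  rw [aeval_algHom_apply]
  congr 1
  have : aeval (C X : F[X][X]) = (CAlgHom : F[X] →ₐ[F] F[X][X]) := by ext; simp
  rw [this]; rfl

/-- The representation of `A_h` on `F[X][Y]` by left multiplication on normal forms. -/
noncomputable def rep : Ah h →ₐ[F] Module.End F F[X][X] :=
  lift h (Algebra.lmul F F[X][X] (C X)) (yOp h) (by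
    rw [aeval_lmul_C_X]
    ext1 p
    change X * (C X * p) + coeffDeriv h (C X * p) = C X * (X * p + coeffDeriv h p) + C h * p
    -- Leibniz rule: `h d/dX` sends `X` to `h`, which is the extra term in the defining relation.
    have : coeffDeriv h (C X * p) = C X * coeffDeriv h p + C h * p := by
      ext1 i
      simp only [coeff_coeffDeriv, coeff_C_mul, coeff_add, derivative_mul, derivative_X]
      ring
    rw [this]
    ring)

@[simp] theorem rep_y (p : F[X][X]) : rep h (y h) p = X * p + coeffDeriv h p := by
  rw [rep, lift_y, yOp_apply]

@[simp] theorem rep_ofPoly (f : F[X]) (p : F[X][X]) : rep h (ofPoly h f) p = C f * p := by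
  rw [ofPoly, ← aeval_algHom_apply, rep, lift_x, aeval_lmul_C_X]
  rfl

theorem rep_x (p : F[X][X]) : rep h (x h) p = C X * p := by
  rw [← rep_ofPoly h]; simp [ofPoly]

/-- The element `∑ pᵢ(x) yⁱ` of `A_h`. -/
noncomputable def ofNormal (p : F[X][X]) : Ah h := eval₂ (ofPoly h : F[X] →+* Ah h) (y h) p

theorem ofNormal_add (p q : F[X][X]) : ofNormal h (p + q) = ofNormal h p + ofNormal h q :=
  eval₂_add _ _

theorem ofNormal_monomial (n : ℕ) (f : F[X]) :
    ofNormal h (monomial n f) = ofPoly h f * y h ^ n := by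
  simp [ofNormal, eval₂_monomial]

theorem y_mul_ofPoly (f : F[X]) :
    y h * ofPoly h f = ofPoly h f * y h + ofPoly h (h * derivative f) := by
  induction f using Polynomial.induction_on with
  | C a => simp [ofPoly, Algebra.commutes]
  | add p q hp hq => simp only [map_add, mul_add, add_mul, hp, hq]; abel
  | monomial n a ih =>
    have e : (C a * X ^ (n + 1) : F[X]) = C a * X ^ n * X := by ring
    have ex : ofPoly h X = x h := by simp [ofPoly]
    rw [e, map_mul, ex, ← mul_assoc, ih, add_mul, mul_assoc, y_mul_x, mul_add, ← mul_assoc,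
      derivative_mul (f := C a * X ^ n) (g := X), derivative_X, mul_one, ← ex, add_assoc,
      ← map_mul, ← map_mul, ← map_mul, ← map_add]
    congr 2
    ring

/-- The universal property gives a map `A_h → S` whose composite with the inclusion fixes both
generators, hence is the identity. -/
theorem mem_of_generators_mem (S : Subalgebra F (Ah h)) (hx : x h ∈ S)
    (hy : y h ∈ S) (a : Ah h) : a ∈ S := by
  let g : Ah h →ₐ[F] S := lift h ⟨x h, hx⟩ ⟨y h, hy⟩ (by
    apply Subtype.ext
    have : ((aeval (⟨x h, hx⟩ : S) h : S) : Ah h) = aeval (x h) h := by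
      rw [← S.coe_val, ← aeval_algHom_apply]; rfl
    simpa [this, ofPoly] using y_mul_x h)
  have : S.val.comp g = AlgHom.id F _ := hom_ext (by simp [g]) (by simp [g])
  rw [← AlgHom.id_apply (R := F) a, ← this]
  exact (g a).2

/-- `ofNormal` is `A_h`-linear for the action `rep`. At `p = 1` this makes `ofNormal` a left inverse
of `nf`, so normal forms exist and `nf` is injective. -/
theorem ofNormal_rep (a : Ah h) (p : F[X][X]) : ofNormal h (rep h a p) = a * ofNormal h p := by
  let S : Subalgebra F (Ah h) :=
    { carrier := {a | ∀ p, ofNormal h (rep h a p) = a * ofNormal h p}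
      mul_mem' := by
        intro a b ha hb p
        rw [map_mul, Module.End.mul_apply, ha, hb, mul_assoc]
      add_mem' := by
        intro a b ha hb p
        rw [map_add, LinearMap.add_apply, ofNormal_add, ha, hb, add_mul]
      algebraMap_mem' := by
        intro r p
        have e : algebraMap F (Ah h) r = ofPoly h (C r) := by simp [ofPoly]
        rw [e, rep_ofPoly]
        induction p using Polynomial.induction_on' with
        | add p q hp hq => rw [mul_add, ofNormal_add, hp, hq, ofNormal_add, mul_add]
        | monomial n f =>
          rw [C_mul_monomial, ofNormal_monomial, ofNormal_monomial, map_mul, mul_assoc] }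
  refine mem_of_generators_mem h S (fun p => ?_) (fun p => ?_) a p
  · rw [rep_x]
    induction p using Polynomial.induction_on' with
    | add p q hp hq => rw [mul_add, ofNormal_add, hp, hq, ofNormal_add, mul_add]
    | monomial n f =>
      rw [C_mul_monomial, ofNormal_monomial, ofNormal_monomial, map_mul, mul_assoc]
      simp [ofPoly]
  · rw [rep_y]
    induction p using Polynomial.induction_on' with
    | add p q hp hq =>
      rw [mul_add, map_add, add_add_add_comm, ofNormal_add, hp, hq, ofNormal_add, mul_add]
    | monomial n f =>
      rw [coeffDeriv_monomial, X_mul_monomial, ofNormal_add, ofNormal_monomial,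
        ofNormal_monomial, ofNormal_monomial, ← mul_assoc, y_mul_ofPoly, add_mul, mul_assoc,
        ← pow_succ']

/-- The normal form `∑ pᵢ(X) Yⁱ` of an element `∑ pᵢ(x) yⁱ` of `A_h`. -/
noncomputable def nf : Ah h →ₗ[F] F[X][X] := (LinearMap.applyₗ 1).comp (rep h).toLinearMap

theorem nf_apply (a : Ah h) : nf h a = rep h a 1 := rfl

theorem nf_mul (a b : Ah h) : nf h (a * b) = rep h a (nf h b) := by
  simp [nf_apply]

@[simp] theorem nf_ofPoly (f : F[X]) : nf h (ofPoly h f) = C f := by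
  simp [nf_apply]

@[simp] theorem ofNormal_nf (a : Ah h) : ofNormal h (nf h a) = a := by
  rw [nf_apply, ofNormal_rep]
  simp [ofNormal]

theorem nf_injective : Function.Injective (nf h) :=
  Function.LeftInverse.injective (ofNormal_nf h)

theorem nf_y : nf h (y h) = X := by
  have : coeffDeriv h 1 = 0 := by
    rw [← C_1, ← monomial_zero_left, coeffDeriv_monomial]; simp
  simp [nf_apply, this]

theorem ofPoly_injective : Function.Injective (ofPoly h) := fun f g e => by
  have := congrArg (nf h) e
  simpa using this

instance : Nontrivial (Ah h) := (ofPoly_injective h).nontrivial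

/-! ### The degree in `y` and its additivity. -/

theorem natDegree_yOp_pow_le_and_coeff {q : F[X][X]} {m : ℕ} (hq : q.natDegree ≤ m) (i : ℕ) :
    ((rep h (y h) ^ i) q).natDegree ≤ i + m ∧ ((rep h (y h) ^ i) q).coeff (i + m) = q.coeff m := by
  induction i with
  | zero => simpa using hq
  | succ i ih =>
    rw [pow_succ', Module.End.mul_apply, rep_y]
    set r := (rep h (y h) ^ i) q
    constructor
    · rw [natDegree_le_iff_coeff_eq_zero]
      rintro (_ | N) hN
      · omega
      · rw [coeff_add, coeff_X_mul, coeff_coeffDeriv, coeff_eq_zero_of_natDegree_lt (by omega),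
          coeff_eq_zero_of_natDegree_lt (by omega)]
        simp
    · rw [show i + 1 + m = (i + m) + 1 by omega, coeff_add, coeff_X_mul, coeff_coeffDeriv, ih.2,
        coeff_eq_zero_of_natDegree_lt (show r.natDegree < i + m + 1 by omega)]
      simp

/-- Only the top term of `a` reaches degree `n + m`, since each `y` raises the `Y`-degree bound by
exactly one and keeps the top coefficient. With `q` the normal form of `b`, this is multiplicativity
of leading terms. -/
theorem natDegree_rep_le_and_coeff (a : Ah h) {q : F[X][X]} {n m : ℕ}
    (ha : (nf h a).natDegree ≤ n) (hq : q.natDegree ≤ m) :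
    (rep h a q).natDegree ≤ n + m ∧
      (rep h a q).coeff (n + m) = (nf h a).coeff n * q.coeff m := by
  have e : rep h a q = ∑ i ∈ Finset.range (n + 1),
      C ((nf h a).coeff i) * (rep h (y h) ^ i) q := by
    conv_lhs => rw [← ofNormal_nf h a, ofNormal, eval₂_eq_sum_range' _ (Nat.lt_succ_of_le ha)]
    simp [LinearMap.sum_apply]
  rw [e]
  constructor
  · refine natDegree_sum_le_of_forall_le _ _ fun i hi => ?_
    have := (natDegree_yOp_pow_le_and_coeff h hq i).1
    have := Finset.mem_range.1 hi
    exact (natDegree_C_mul_le _ _).trans (by omega)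
  · rw [finsetSum_coeff, Finset.sum_range_succ, coeff_C_mul,
      (natDegree_yOp_pow_le_and_coeff h hq n).2, Finset.sum_eq_zero, zero_add]
    intro i hi
    have := (natDegree_yOp_pow_le_and_coeff h hq i).1
    have := Finset.mem_range.1 hi
    rw [coeff_C_mul, coeff_eq_zero_of_natDegree_lt (n := n + m) (by omega), mul_zero]

/-- The degree in `y`. -/
noncomputable def ydeg (a : Ah h) : ℕ := (nf h a).natDegree

variable {h}

theorem nf_ne_zero {a : Ah h} (ha : a ≠ 0) : nf h a ≠ 0 :=
  (map_ne_zero_iff _ (nf_injective h)).2 ha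

theorem coeff_nf_mul (a b : Ah h) :
    (nf h (a * b)).coeff (ydeg h a + ydeg h b) =
      (nf h a).leadingCoeff * (nf h b).leadingCoeff := by
  rw [nf_mul]
  exact (natDegree_rep_le_and_coeff h a le_rfl le_rfl).2

instance : NoZeroDivisors (Ah h) where
  eq_zero_or_eq_zero_of_mul_eq_zero {a b} hab := by
    by_contra! H
    have := coeff_nf_mul a b
    rw [hab, map_zero, coeff_zero, eq_comm, mul_eq_zero, leadingCoeff_eq_zero,
      leadingCoeff_eq_zero] at this
    exact this.elim (nf_ne_zero H.1) (nf_ne_zero H.2)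

theorem ydeg_mul {a b : Ah h} (ha : a ≠ 0) (hb : b ≠ 0) :
    ydeg h (a * b) = ydeg h a + ydeg h b := by
  refine natDegree_eq_of_le_of_coeff_ne_zero ?_ ?_
  · rw [nf_mul]
    exact (natDegree_rep_le_and_coeff h a le_rfl le_rfl).1
  · rw [coeff_nf_mul]
    simp [nf_ne_zero ha, nf_ne_zero hb]

@[simp] theorem ydeg_ofPoly (f : F[X]) : ydeg h (ofPoly h f) = 0 := by simp [ydeg]

theorem exists_ofPoly_of_ydeg_eq_zero {a : Ah h} (ha : ydeg h a = 0) : ∃ f, a = ofPoly h f := by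
  refine ⟨(nf h a).coeff 0, nf_injective h ?_⟩
  rw [nf_ofPoly]
  exact eq_C_of_natDegree_eq_zero ha

theorem ydeg_pow {a : Ah h} (ha : a ≠ 0) (i : ℕ) : ydeg h (a ^ i) = i * ydeg h a := by
  induction i with
  | zero => simpa using ydeg_ofPoly (h := h) 1
  | succ i ih => rw [pow_succ, ydeg_mul (pow_ne_zero _ ha) ha, ih, add_one_mul]

/-- The powers of `z` have pairwise distinct `y`-degrees, so the top term cannot cancel. -/
theorem ydeg_eval₂ {z : Ah h} (hz : 0 < ydeg h z) {p : F[X][X]} (hp : p ≠ 0) :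
    ydeg h (eval₂ (ofPoly h : F[X] →+* Ah h) z p) = p.natDegree * ydeg h z := by
  have hz0 : z ≠ 0 := by
    rintro rfl
    simp [ydeg] at hz
  have e : nf h (eval₂ (ofPoly h : F[X] →+* Ah h) z p) =
      ∑ i ∈ Finset.range (p.natDegree + 1), C (p.coeff i) * nf h (z ^ i) := by
    rw [eval₂_eq_sum_range, map_sum]
    exact Finset.sum_congr rfl fun i _ => by rw [nf_mul, RingHom.coe_coe, rep_ofPoly]
  have hd : ∀ i, (nf h (z ^ i)).natDegree = i * ydeg h z := ydeg_pow hz0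
  refine natDegree_eq_of_le_of_coeff_ne_zero ?_ ?_
  · rw [e]
    refine natDegree_sum_le_of_forall_le _ _ fun i hi => (natDegree_C_mul_le _ _).trans ?_
    rw [hd]
    exact Nat.mul_le_mul_right _ (Nat.lt_succ_iff.1 (Finset.mem_range.1 hi))
  · rw [e, finsetSum_coeff, Finset.sum_range_succ, Finset.sum_eq_zero, zero_add, coeff_C_mul,
      ← hd]
    · exact mul_ne_zero (leadingCoeff_ne_zero.2 hp)
        (leadingCoeff_ne_zero.2 (nf_ne_zero (pow_ne_zero _ hz0)))
    · intro i hi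
      rw [coeff_C_mul, coeff_eq_zero_of_natDegree_lt (p := nf h (z ^ i)), mul_zero]
      rw [hd]
      exact Nat.mul_lt_mul_of_pos_right (Finset.mem_range.1 hi) hz

end NormalForm

/-! ### Reduction modulo `h` and the images of the generators under an automorphism. -/

section Automorphisms

variable {F : Type u} [Field F] (h : F[X])

/-- The quotient map `A_h → A_h / h A_h = (F[x] / h)[y]`. -/
noncomputable def modH : Ah h →ₐ[F] (AdjoinRoot h)[X] :=
  lift h (C (AdjoinRoot.root h)) X (by
    have : aeval (C (AdjoinRoot.root h)) h = C (aeval (AdjoinRoot.root h) h) :=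
      aeval_algHom_apply (CAlgHom : AdjoinRoot h →ₐ[F] (AdjoinRoot h)[X]) _ _
    rw [this, AdjoinRoot.aeval_eq, AdjoinRoot.mk_self, C_0, add_zero, mul_comm])

theorem modH_ofPoly (f : F[X]) : modH h (ofPoly h f) = C (AdjoinRoot.mk h f) := by
  rw [ofPoly, ← aeval_algHom_apply, modH, lift_x, ← AdjoinRoot.aeval_eq]
  exact aeval_algHom_apply (CAlgHom : AdjoinRoot h →ₐ[F] (AdjoinRoot h)[X]) _ _

theorem exists_eq_mul_of_modH_eq_zero {a : Ah h} (ha : modH h a = 0) :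
    ∃ b, a = ofPoly h h * b := by
  -- The quotient map reduces the coefficients of the normal form modulo `h`; they stand on the
  -- left, so `h` factors out on the left.
  have e : modH h a = (nf h a).map (AdjoinRoot.mk h) := by
    conv_lhs => rw [← ofNormal_nf h a, ofNormal, ← RingHom.coe_coe, hom_eval₂]
    rw [Polynomial.map]
    congr 1
    · exact RingHom.ext fun f => modH_ofPoly h f
    · simp [modH]
  have hd : C h ∣ nf h a := by
    rw [C_dvd_iff_dvd_coeff]
    intro i
    rw [← AdjoinRoot.mk_eq_zero, ← coeff_map, ← e, ha, coeff_zero]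
  obtain ⟨q, hq⟩ := hd
  refine ⟨ofNormal h q, ?_⟩
  rw [← ofNormal_rep, rep_ofPoly, ← hq, ofNormal_nf]

variable {h}

theorem exists_map_ofPoly_self (σ : Ah h ≃ₐ[F] Ah h) : ∃ b, σ (ofPoly h h) = ofPoly h h * b := by
  refine exists_eq_mul_of_modH_eq_zero h ?_
  have e : ofPoly h h = y h * x h - x h * y h := by rw [y_mul_x]; abel
  rw [e, map_sub, map_mul, map_mul, map_sub, map_mul, map_mul, mul_comm, sub_self]

theorem ydeg_map_x (hdeg : 1 ≤ h.natDegree) (σ : Ah h ≃ₐ[F] Ah h) : ydeg h (σ (x h)) = 0 := by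
  have h0 : h ≠ 0 := by rintro rfl; simp at hdeg
  have hp0 : ofPoly h h ≠ 0 := (map_ne_zero_iff _ (ofPoly_injective h)).2 h0
  obtain ⟨b, hb⟩ := exists_map_ofPoly_self σ⁻¹
  -- Apply `σ` to `σ⁻¹(h) = h b`.
  have e : ofPoly h h = σ (ofPoly h h) * σ b := by
    rw [← map_mul, ← hb]
    exact (σ.apply_symm_apply _).symm
  have hne := hp0
  rw [e, mul_ne_zero_iff] at hne
  have e1 := congrArg (ydeg h) e
  rw [ydeg_mul hne.1 hne.2, ydeg_ofPoly] at e1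
  by_contra hx
  -- `σ(h) = h(σ(x))` has `y`-degree `deg h` times that of `σ(x)`, were the latter positive.
  have e2 : σ (ofPoly h h) = eval₂ (ofPoly h : F[X] →+* Ah h) (σ (x h)) (h.map C) := by
    rw [ofPoly, eval₂_map, ← aeval_algHom_apply σ, aeval_def]
    congr 1
    ext1 c
    simp
  rw [e2, ydeg_eval₂ (Nat.pos_of_ne_zero hx) ((Polynomial.map_ne_zero_iff C_injective).2 h0),
    natDegree_map_eq_of_injective C_injective] at e1
  have := Nat.mul_pos hdeg (Nat.pos_of_ne_zero hx)
  omega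

theorem map_ofPoly {σ : Ah h ≃ₐ[F] Ah h} {g : F[X]} (hg : σ (x h) = ofPoly h g) (f : F[X]) :
    σ (ofPoly h f) = ofPoly h (f.comp g) := by
  rw [ofPoly, ← aeval_algHom_apply σ, hg, ofPoly, ← aeval_comp]

theorem exists_affine (hdeg : 1 ≤ h.natDegree) (σ : Ah h ≃ₐ[F] Ah h) :
    ∃ p ∈ affinePairs h, σ (x h) = ofPoly h (C (p.1 : F) * X + C p.2) := by
  have h0 : h ≠ 0 := by rintro rfl; simp at hdeg
  obtain ⟨g, hg⟩ := exists_ofPoly_of_ydeg_eq_zero (ydeg_map_x hdeg σ)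
  obtain ⟨g', hg'⟩ := exists_ofPoly_of_ydeg_eq_zero (ydeg_map_x hdeg σ⁻¹)
  -- This is `σ(σ⁻¹(x)) = x`; comparing degrees makes `g` affine.
  have e : g'.comp g = X := by
    apply ofPoly_injective h
    rw [← map_ofPoly hg, ← hg']
    simp [ofPoly]
  have hd : g.natDegree = 1 := by
    have := congrArg natDegree e
    rw [natDegree_comp, natDegree_X] at this
    exact Nat.eq_one_of_mul_eq_one_left this
  have hα : g.coeff 1 ≠ 0 := by
    rw [← hd]
    exact leadingCoeff_ne_zero.2 (by rintro rfl; simp at hd)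
  have hgg : g = C (g.coeff 1) * X + C (g.coeff 0) := eq_X_add_C_of_natDegree_le_one hd.le
  refine ⟨(Units.mk0 _ hα, g.coeff 0), ?_, by rw [hg]; exact congrArg _ hgg⟩
  obtain ⟨b, hb⟩ := exists_map_ofPoly_self σ
  have hp0 : ofPoly h h ≠ 0 := (map_ne_zero_iff _ (ofPoly_injective h)).2 h0
  have hb0 : b ≠ 0 := by
    rintro rfl
    rw [mul_zero, map_eq_zero_iff _ σ.injective] at hb
    exact hp0 hb
  have hb1 := congrArg (ydeg h) hb
  rw [map_ofPoly hg, ydeg_mul hp0 hb0, ydeg_ofPoly, ydeg_ofPoly, zero_add] at hb1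
  obtain ⟨f, rfl⟩ := exists_ofPoly_of_ydeg_eq_zero hb1.symm
  rw [map_ofPoly hg, ← map_mul] at hb
  replace hb := ofPoly_injective h hb
  have hf0 : f ≠ 0 := by rintro rfl; simp at hb0
  -- Here `h ∘ g = h f`: equal degrees make `f` constant, and the leading coefficients give `f = α ^
  -- deg h`.
  have hfd := congrArg natDegree hb
  rw [natDegree_comp, hd, natDegree_mul h0 hf0] at hfd
  have hfc := eq_C_of_natDegree_eq_zero (p := f) (by omega)
  have hlc := congrArg leadingCoeff hb
  rw [leadingCoeff_comp (by omega), leadingCoeff_mul, hfc, leadingCoeff_C, leadingCoeff,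
    leadingCoeff, hd] at hlc
  have hc := mul_left_cancel₀ (leadingCoeff_ne_zero.2 h0) hlc
  simp only [affinePairs, Set.mem_ofPred_eq, Units.val_mk0]
  rw [← hgg, hb, hc, ← hfc, mul_comm]

theorem ydeg_map_y (hdeg : 1 ≤ h.natDegree) (σ : Ah h ≃ₐ[F] Ah h) : ydeg h (σ (y h)) = 1 := by
  have h0 : h ≠ 0 := by rintro rfl; simp at hdeg
  have hp0 : ofPoly h h ≠ 0 := (map_ne_zero_iff _ (ofPoly_injective h)).2 h0
  obtain ⟨g, hg⟩ := exists_ofPoly_of_ydeg_eq_zero (ydeg_map_x hdeg σ)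
  -- Otherwise `σ(y)` would commute with `σ(x)`, forcing `σ(h) = 0`.
  have hpos : 0 < ydeg h (σ (y h)) := by
    by_contra hy
    obtain ⟨k, hk⟩ := exists_ofPoly_of_ydeg_eq_zero (Nat.eq_zero_of_not_pos hy)
    have e := congrArg σ (y_mul_x h)
    rw [map_add, map_mul, map_mul, hg, hk, ← map_mul, ← map_mul, mul_comm, left_eq_add,
      map_eq_zero_iff _ σ.injective] at e
    exact hp0 e
  -- Applying `σ` to the normal form of `σ⁻¹(y)` writes `y` as a polynomial in `σ(y)` with
  -- coefficients in `F[x]`, so the `y`-degree of `σ(y)` divides `1`.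
  have e : y h = eval₂ (ofPoly h : F[X] →+* Ah h) (σ (y h))
      ((nf h (σ.symm (y h))).map (compRingHom g)) := by
    conv_lhs => rw [← σ.apply_symm_apply (y h), ← ofNormal_nf h (σ.symm (y h)), ofNormal]
    rw [eval₂_map]
    refine (hom_eval₂ _ _ (σ : Ah h →+* Ah h) _).trans ?_
    congr 1
    exact RingHom.ext fun f => map_ofPoly hg f
  have e1 := congrArg (ydeg h) e
  have hne : (nf h (σ.symm (y h))).map (compRingHom g) ≠ 0 := by
    intro h1
    rw [h1, eval₂_zero] at e
    have := congrArg (nf h) e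
    rw [nf_y, map_zero] at this
    exact X_ne_zero this
  rw [ydeg_eval₂ hpos hne, ydeg, nf_y, natDegree_X] at e1
  exact Nat.eq_one_of_mul_eq_one_left e1.symm

theorem exists_phi_mul_tau (hdeg : 1 ≤ h.natDegree) (σ : Ah h ≃ₐ[F] Ah h) :
    ∃ (f : F[X]) (p : Fˣ × F) (hp : p ∈ affinePairs h), σ = phi h f * tau h p hp := by
  have h0 : h ≠ 0 := by rintro rfl; simp at hdeg
  obtain ⟨p, hp, hx⟩ := exists_affine hdeg σ
  have hnd := ydeg_map_y hdeg σ
  obtain ⟨u, v, huv⟩ : ∃ u v : F[X], σ (y h) = ofPoly h u * y h + ofPoly h v := by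
    refine ⟨(nf h (σ (y h))).coeff 1, (nf h (σ (y h))).coeff 0, ?_⟩
    conv_lhs => rw [← ofNormal_nf h (σ (y h)), eq_X_add_C_of_natDegree_le_one (le_of_eq hnd)]
    rw [ofNormal_add, C_mul_X_eq_monomial, ← monomial_zero_left, ofNormal_monomial,
      ofNormal_monomial]
    simp
  set γ : Fˣ := p.1 ^ ((h.natDegree : ℤ) - 1) with hγ
  have hu : u = C (γ : F) := by
    -- The image of the relation reduces to `u h α = h(αx + β) = α ^ (deg h) h`, as `v` commutes
    -- with `αx + β`.
    have e := congrArg σ (y_mul_x h)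
    rw [map_add, map_mul, map_mul, map_ofPoly hx, hp, hx, huv, add_mul, mul_assoc, y_mul_ofPoly,
      mul_add, mul_add, ← mul_assoc, ← mul_assoc, ← map_mul, ← map_mul, ← map_mul, ← map_mul,
      ← map_mul, mul_comm u (C _ * X + C _), mul_comm v, add_assoc, add_assoc, add_right_inj,
      add_comm, add_right_inj] at e
    replace e := ofPoly_injective h e
    have e3 : (γ : F) * (p.1 : F) = (p.1 : F) ^ h.natDegree := by
      rw [← Units.val_mul, hγ, ← zpow_add_one, sub_add_cancel, zpow_natCast,
        Units.val_pow_eq_pow_val]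
    rw [← e3, C_mul] at e
    simp only [derivative_add, derivative_mul, derivative_C, derivative_X, zero_mul, zero_add,
      mul_one, add_zero] at e
    have hne : h * C (p.1 : F) ≠ 0 := mul_ne_zero h0 (C_ne_zero.2 p.1.ne_zero)
    apply mul_right_cancel₀ hne
    rw [e]
    ring
  -- `φ_f τ` sends `y` to `γ (y + f)`, so `γ f = v`.
  refine ⟨C ((γ⁻¹ : Fˣ) : F) * v, p, hp, equiv_ext ?_ ?_⟩
  · rw [hx]
    simp [ofPoly, Algebra.smul_def]
  · have e1 : ∀ (c : F) (f : F[X]), c • ofPoly h f = ofPoly h (C c * f) := by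
      intro c f
      simp [ofPoly, Algebra.smul_def]
    rw [huv, hu, AlgEquiv.mul_apply, tau_y, map_smul, phi_y, smul_add, e1, ← mul_assoc, ← C_mul,
      ← hγ, Units.mul_inv, C_1, one_mul]
    simp [ofPoly, Algebra.smul_def]

/-! ### Semidirect decompositions and the group of translations. -/

theorem tau_mul_phi {p : Fˣ × F} (hp : p ∈ affinePairs h) (f : F[X]) :
    tau h p hp * phi h f =
      phi h (C (((p.1 ^ ((h.natDegree : ℤ) - 1))⁻¹ : Fˣ) : F) *
        f.comp (C (p.1 : F) * X + C p.2)) * tau h p hp := by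
  have e1 : ∀ (c : F) (f : F[X]), c • ofPoly h f = ofPoly h (C c * f) := by
    intro c f
    simp [ofPoly, Algebra.smul_def]
  have hx : tau h p hp (x h) = ofPoly h (C (p.1 : F) * X + C p.2) := by
    simp [ofPoly, Algebra.smul_def]
  refine equiv_ext ?_ ?_
  · rw [AlgEquiv.mul_apply, AlgEquiv.mul_apply, phi_x, hx, phi_ofPoly]
  · rw [AlgEquiv.mul_apply, AlgEquiv.mul_apply, phi_y, map_add, map_ofPoly hx, tau_y, map_smul,
      phi_y, smul_add, e1, ← mul_assoc, ← C_mul, Units.mul_inv, C_1, one_mul]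

theorem phi_mem (f : F[X]) : phi h f ∈ phiSubgroup h := ⟨Multiplicative.ofAdd f, rfl⟩

theorem phiMonoidHom_injective : Function.Injective (phiMonoidHom h) := fun f g e => by
  have := DFunLike.congr_fun e (y h)
  change phi h f.toAdd (y h) = phi h g.toAdd (y h) at this
  rw [phi_y, phi_y, add_right_inj] at this
  exact ofPoly_injective h this

theorem tau_conj_mem {p : Fˣ × F} (hp : p ∈ affinePairs h) {g : Ah h ≃ₐ[F] Ah h}
    (hg : g ∈ phiSubgroup h) : tau h p hp * g * (tau h p hp)⁻¹ ∈ phiSubgroup h := by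
  obtain ⟨f, rfl⟩ := hg
  change tau h p hp * phi h f.toAdd * _ ∈ _
  rw [tau_mul_phi, mul_inv_cancel_right]
  exact phi_mem _

theorem phiSubgroup_normal (hdeg : 1 ≤ h.natDegree) : (phiSubgroup h).Normal where
  conj_mem n hn σ := by
    obtain ⟨f, p, hp, rfl⟩ := exists_phi_mul_tau hdeg σ
    have := mul_mem (mul_mem (phi_mem f) (tau_conj_mem hp hn)) (inv_mem (phi_mem f))
    simpa [mul_assoc] using this

theorem tau_apply_x_injective {p q : Fˣ × F} {hp : p ∈ affinePairs h} {hq : q ∈ affinePairs h}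
    (e : tau h p hp (x h) = tau h q hq (x h)) : p = q := by
  have e1 : ofPoly h (C (p.1 : F) * X + C p.2) = ofPoly h (C (q.1 : F) * X + C q.2) := by
    simpa [ofPoly, Algebra.smul_def] using e
  replace e1 := ofPoly_injective h e1
  have h0 := congrArg (coeff · 0) e1
  have h1 := congrArg (coeff · 1) e1
  simp at h0 h1
  exact Prod.ext (Units.ext h1) h0

theorem phiSubgroup_inf_tauP : phiSubgroup h ⊓ tauP h = ⊥ := by
  rw [eq_bot_iff]
  rintro _ ⟨⟨f, hf⟩, ⟨p, hp, rfl⟩⟩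
  have e : tau h p hp (x h) = tau h (1, 0) (affinePairs_one h) (x h) := by
    rw [← hf]
    change phi h f.toAdd (x h) = _
    simp
  rw [Subgroup.mem_bot, ← tau_one, tau_congr hp (tau_apply_x_injective e)]

theorem phiSubgroup_sup_tauP (hdeg : 1 ≤ h.natDegree) : phiSubgroup h ⊔ tauP h = ⊤ := by
  rw [eq_top_iff]
  intro σ _
  obtain ⟨f, p, hp, rfl⟩ := exists_phi_mul_tau hdeg σ
  exact Subgroup.mul_mem_sup (phi_mem f) ⟨p, hp, rfl⟩

theorem tauOneG_le_tauP : tauOneG h ≤ tauP h := by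
  rintro _ ⟨ν, hν, rfl⟩
  exact ⟨_, hν, rfl⟩

theorem tauP_conj_tauOneG {σ g : Ah h ≃ₐ[F] Ah h} (hσ : σ ∈ tauP h) (hg : g ∈ tauOneG h) :
    σ * g * σ⁻¹ ∈ tauOneG h := by
  obtain ⟨p, hp, rfl⟩ := hσ
  obtain ⟨ν, hν, rfl⟩ := hg
  rw [tau_inv, tau_mul, tau_mul]
  -- Conjugating the translation by `ν` with `τ_{α,β}` gives the translation by `α⁻¹ ν`.
  have key : (((p.1, p.2).1 * 1 * p.1⁻¹, ((p.1⁻¹ : Fˣ) : F) * (((1 : Fˣ) : F) * p.2 + ν) +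
      -((p.1⁻¹ : Fˣ) : F) * p.2) : Fˣ × F) = (1, ((p.1⁻¹ : Fˣ) : F) * ν) := by
    ext
    · simp
    · simp [mul_add]
  have hm := affinePairs_mul h (affinePairs_mul h hp hν) (affinePairs_inv h hp)
  exact ⟨((p.1⁻¹ : Fˣ) : F) * ν, key ▸ hm, (tau_congr hm key).symm⟩

/-- Conjugation by `τ_ℙ` preserves both factors, and each `φ_f` already lies in the subgroup. -/
theorem sup_tauOneG_normal (hdeg : 1 ≤ h.natDegree) : (phiSubgroup h ⊔ tauOneG h).Normal where
  conj_mem n hn σ := by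
    have hN := phiSubgroup_normal hdeg
    obtain ⟨f, p, hp, rfl⟩ := exists_phi_mul_tau hdeg σ
    obtain ⟨a, ha, t, ht, rfl⟩ := Subgroup.mem_sup_of_normal_left.1 hn
    have h1 := Subgroup.mul_mem_sup (tau_conj_mem hp ha) (tauP_conj_tauOneG ⟨p, hp, rfl⟩ ht)
    have h2 : phi h f ∈ phiSubgroup h ⊔ tauOneG h := Subgroup.mem_sup_left (phi_mem f)
    have := mul_mem (mul_mem h2 h1) (inv_mem h2)
    simpa [mul_assoc] using this

variable (h) in
/-- The group `𝔾` of all `ν` with `(1, ν) ∈ ℙ`. -/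
def shifts : AddSubgroup F where
  carrier := {ν | ((1, ν) : Fˣ × F) ∈ affinePairs h}
  zero_mem' := affinePairs_one h
  add_mem' {a b} ha hb := by
    have := affinePairs_mul h ha hb
    simpa using this
  neg_mem' {a} ha := by
    have := affinePairs_inv h ha
    simpa using this

/-- Evaluating `h(x + ν) = h(x)` at `0` makes `ν` a root of the nonzero polynomial `h - h(0)`. -/
theorem shifts_finite (hdeg : 1 ≤ h.natDegree) : (shifts h : Set F).Finite := by
  classical
  have hne : h - C (h.eval 0) ≠ 0 := by
    intro e
    rw [sub_eq_zero.1 e, natDegree_C] at hdeg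
    omega
  refine ((h - C (h.eval 0)).roots.toFinset.finite_toSet).subset fun ν hν => ?_
  have e : h.comp (C ((1 : Fˣ) : F) * X + C ν) = C (((1 : Fˣ) : F) ^ h.natDegree) * h := hν
  have e1 := congrArg (eval 0) e
  simp only [eval_comp, Units.val_one, one_pow, C_1, one_mul, eval_add, eval_X, eval_C,
    zero_add] at e1
  simp [hne, e1]

/-- In characteristic zero the multiples of a nonzero `ν` are pairwise distinct, contradicting
finiteness. -/
theorem shifts_eq_bot [CharZero F] (hdeg : 1 ≤ h.natDegree) : shifts h = ⊥ := by
  rw [AddSubgroup.eq_bot_iff_forall]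
  intro ν hν
  by_contra h0
  refine Set.infinite_of_injective_forall_mem (f := fun n : ℕ => n • ν) ?_
    (fun n => (shifts h).nsmul_mem hν n) (shifts_finite hdeg)
  intro a b hab
  simpa [h0] using hab

variable (h) in
/-- The isomorphism `ν ↦ τ_{1,ν}` from `𝔾` onto `τ_{1,𝔾}`. -/
noncomputable def shiftsEquiv : Multiplicative (shifts h) ≃* tauOneG h :=
  MulEquiv.ofBijective
    ({ toFun := fun ν => ⟨tau h (1, (ν.toAdd : F)) ν.toAdd.2, _, ν.toAdd.2, rfl⟩
       map_one' := Subtype.ext (tau_one h)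
       map_mul' := fun a b => Subtype.ext (by
          refine Eq.symm ((tau_mul h a.toAdd.2 b.toAdd.2).trans ?_)
          exact tau_congr _ (by simp)) } : Multiplicative (shifts h) →* tauOneG h)
    ⟨fun a b e => by
      have e1 := congrArg Subtype.val e
      have := tau_apply_x_injective (DFunLike.congr_fun e1 (x h))
      exact Subtype.ext (Prod.ext_iff.1 this).2, by
      rintro ⟨_, ν, hν, rfl⟩
      exact ⟨Multiplicative.ofAdd ⟨ν, hν⟩, rfl⟩⟩

end Automorphisms

end Ah

theorem mainTheorem3 {F : Type u} [Field F] (h : F[X]) (hdeg : 1 ≤ h.natDegree) :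
    (Function.Injective (Ah.phiMonoidHom h) ∧
      (Ah.phiSubgroup h).Normal ∧
      IsInternalSemidirect (Ah.phiSubgroup h) (Ah.tauP h) ⊤) ∧
    (∃ H : AddSubgroup F, (H : Set F).Finite ∧
      Nonempty (Ah.tauOneG h ≃* Multiplicative H) ∧
      (CharZero F → H = ⊥)) ∧
    (∃ S : Subgroup (Ah h ≃ₐ[F] Ah h),
      IsInternalSemidirect (Ah.phiSubgroup h) (Ah.tauOneG h) S ∧ S.Normal) := by
  have hN := Ah.phiSubgroup_normal hdeg
  refine ⟨⟨Ah.phiMonoidHom_injective, hN, ?_⟩,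
    ⟨Ah.shifts h, Ah.shifts_finite hdeg, ⟨(Ah.shiftsEquiv h).symm⟩,
      fun _ => Ah.shifts_eq_bot hdeg⟩,
    ⟨Ah.phiSubgroup h ⊔ Ah.tauOneG h, ?_, Ah.sup_tauOneG_normal hdeg⟩⟩
  · exact ⟨le_top, le_top, inferInstance, Ah.phiSubgroup_inf_tauP, Ah.phiSubgroup_sup_tauP hdeg⟩
  · refine ⟨le_sup_left, le_sup_right, inferInstance, ?_, rfl⟩
    rw [eq_bot_iff, ← Ah.phiSubgroup_inf_tauP]
    exact inf_le_inf_left _ Ah.tauOneG_le_tauP
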